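/- Let $q\in\mathbb{C}$ with $|q|<1$, and write $(a;q)_n=\prod_{k=0}^{n-1}(1-aq^k)$, $(a;q)_\infty=\prod_{k=0}^{\infty}(1-aq^k)$ and $(a_1,\dots,a_\ell;q)_\infty=\prod_{i=1}^{\ell}(a_i;q)_\infty$ (with $0^0=1$ when $q=0$). For integers $m,n\ge 0$ let the 2D $q$-Hermite polynomials $H_{m,n}(z_1,z_2\mid q)$ be defined by $$ \frac{H_{m,n}(z_1,z_2\mid q)}{(q;q)_m(q;q)_n}=\sum_{k=0}^{\min(m,n)}\frac{(-1)^kq^{\binom k2}\,z_1^{m-k}z_2^{n-k}}{(q;q)_{m-k}(q;q)_{n-k}(q;q)_k}. $$ Let $r_1,r_2,s_1,s_2,z_1,z_2,z_3,z_4\in\mathbb{C}$ satisfy $|r_1z_1|<1$, $|s_1z_2|<1$, $|r_2z_3|<1$ and $|s_2z_4|<1$. Then $$ \begin{gathered} \frac{2\,\left(r_1s_1,r_1s_1,r_2s_2,r_2s_2,r_1s_1r_2s_2z_1z_2z_3z_4;q\right)_\infty} {\left(r_1s_1z_1z_2,\,r_1r_2z_1z_3,\,r_1s_2z_1z_4,\,r_2s_1z_2z_3,\,s_1s_2z_2z_4,\,r_2s_2z_3z_4;q\right)_\infty}\\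 =\sum\frac{H_{m_1,n_1}(z_1,z_2\mid q)\,H_{m_2,n_2}(z_1,z_2\mid q)}{(q;q)_{m_1}(q;q)_{n_1}(q;q)_{m_2}(q;q)_{n_2}}\;r_1^{m_1+m_2}r_2^{m_3+m_4}s_1^{n_1+n_2}s_2^{n_3+n_4}\\ \times\frac{H_{m_3,n_3}(z_3,z_4\mid q)\,H_{m_4,n_4}(z_3,z_4\mid q)}{(q;q)_{m_3}(q;q)_{n_3}(q;q)_{m_4}(q;q)_{n_4}}\;(-1)^M\left[q^{\binom M2}+q^{\binom{-M}2}\right], \end{gathered} $$ where the sum, which converges absolutely, is over all nonnegative integers $m_j,n_j$ ($1\le j\le 4$) such that $m_1+n_2+m_3+n_4-n_1-m_2-n_3-m_4$ is even, this even integer is denoted $2M$, and $\binom{x}{2}=x(x-1)/2$ for every integer $x$. -/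

import Mathlib

/-- The finite `q`-shifted factorial `(a; q)_n = ∏_{k=0}^{n-1} (1 - a q^k)`. -/
noncomputable def qPoch (a q : ℂ) (n : ℕ) : ℂ :=
  ∏ k ∈ Finset.range n, (1 - a * q ^ k)

/-- The infinite `q`-shifted factorial `(a; q)_∞ = ∏_{k=0}^∞ (1 - a q^k)`, for `|q| < 1`. -/
noncomputable def qPochInf (a q : ℂ) : ℂ :=
  ∏' k : ℕ, (1 - a * q ^ k)

/-- For `|q| < 1` the product that defines `(a; q)_∞` converges. -/
theorem multipliable_qPochInf (a q : ℂ) (hq : ‖q‖ < 1) :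
    Multipliable (fun k : ℕ => 1 - a * q ^ k) := by
  have h : Summable (fun k : ℕ => ‖-(a * q ^ k)‖) := by
    simpa [norm_mul, norm_pow] using
      (summable_geometric_of_lt_one (norm_nonneg q) hq).mul_left ‖a‖
  simpa [sub_eq_add_neg] using multipliable_one_add_of_summable h

/-- The 2D `q`-Hermite polynomial `H_{m,n}(z₁, z₂ | q)`:
`H_{m,n}(z₁, z₂ | q) / ((q;q)_m (q;q)_n)
  = ∑_{k=0}^{min(m,n)} (-1)^k q^{k(k-1)/2} z₁^{m-k} z₂^{n-k} /
      ((q;q)_{m-k} (q;q)_{n-k} (q;q)_k)`. -/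
noncomputable def qHermite2D (m n : ℕ) (z₁ z₂ q : ℂ) : ℂ :=
  qPoch q q m * qPoch q q n *
    ∑ k ∈ Finset.range (min m n + 1),
      (-1) ^ k * q ^ (k.choose 2) * z₁ ^ (m - k) * z₂ ^ (n - k) /
        (qPoch q q (m - k) * qPoch q q (n - k) * qPoch q q k)

/-- The integer `m₁ + n₂ + m₃ + n₄ - n₁ - m₂ - n₃ - m₄`
(the indices `1, 2, 3, 4` are `0, 1, 2, 3` here). -/
def indexDiff (m n : Fin 4 → ℕ) : ℤ :=
  (m 0 : ℤ) + n 1 + m 2 + n 3 - n 0 - m 1 - n 2 - m 3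

/-- The weight `(-1)^M (q^{binom(M,2)} + q^{binom(-M,2)})` for an integer `M`, where
`binom(x, 2) = x (x - 1) / 2` is the generalized binomial coefficient. -/
noncomputable def qWeight (q : ℂ) (M : ℤ) : ℂ :=
  (-1) ^ M * (q ^ (Ring.choose M 2) + q ^ (Ring.choose (-M) 2))

/-! Work in the Banach algebra of continuous functions on the circle, with x = `fourier 1` and y =
`fourier (-1)`, so that xy = 1. The generating function of the `qHermite2D`, weighted by x^m y^n, is
(rs)_∞ / (r z₁ x, s z₂ y)_∞ (`qHermite_generating`). Multiply four of these, with x and y exchanged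
in the second and fourth. The denominator becomes the product of (tx, ty)_∞ over t = r₁z₁, s₁z₂,
r₂z₃, s₂z₄, and the exponent of x becomes `indexDiff`. Then apply the continuous functional
`thetaFunctional`, which sends x^(2M) to `qWeight q M` and odd powers to 0. The expanded product
gives the series, and the closed product gives an Askey–Wilson integral.

That integral (`thetaFunctional_eulerSeries`) is evaluated through the Rogers–Szegő polynomials h_n.
Their linearization formula (`rogersSzego_mul`) yields Carlitz's q-Mehler formula. Together with the
vanishing of the functional on h_N for N > 0 (`sum_thetaMoment`), it also yields their
orthogonality. The integrand is a product of two Mehler series, with parameters a, b and c, d.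
Orthogonality collapses their pairing to a single Mehler series evaluated at (c, d), which the
q-Mehler formula sums once more, this time over ℂ. -/

open Filter Topology

/-! ### Euler's two q-exponential series. -/

/-- The reciprocal `1 / (q; q)_n`. -/
noncomputable def qInv (q : ℂ) (n : ℕ) : ℂ := (qPoch q q n)⁻¹

theorem one_sub_pow_ne_zero {q : ℂ} (hq : ‖q‖ < 1) (n : ℕ) : 1 - q ^ (n + 1) ≠ 0 := by
  intro h
  have h1 : ‖q ^ (n + 1)‖ < 1 := by
    rw [norm_pow]; exact pow_lt_one₀ (norm_nonneg q) hq (Nat.succ_ne_zero n)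
  rw [← sub_eq_zero.mp h, norm_one] at h1
  exact lt_irrefl _ h1

theorem qPoch_zero (a q : ℂ) : qPoch a q 0 = 1 := by simp [qPoch]

theorem qPoch_self_succ (q : ℂ) (n : ℕ) :
    qPoch q q (n + 1) = qPoch q q n * (1 - q ^ (n + 1)) := by
  rw [qPoch, Finset.prod_range_succ, pow_succ' q n]; rfl

theorem qPoch_self_ne_zero {q : ℂ} (hq : ‖q‖ < 1) (n : ℕ) : qPoch q q n ≠ 0 := by
  rw [qPoch]
  refine Finset.prod_ne_zero_iff.mpr fun k _ => ?_
  rw [← pow_succ']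
  exact one_sub_pow_ne_zero hq k

theorem qInv_zero (q : ℂ) : qInv q 0 = 1 := by simp [qInv, qPoch_zero]

theorem qInv_succ {q : ℂ} (hq : ‖q‖ < 1) (n : ℕ) :
    (1 - q ^ (n + 1)) * qInv q (n + 1) = qInv q n := by
  rw [qInv, qInv, qPoch_self_succ]
  have := one_sub_pow_ne_zero hq n
  have := qPoch_self_ne_zero hq n
  field_simp

theorem qPoch_mul_qInv {q : ℂ} (hq : ‖q‖ < 1) (n : ℕ) : qPoch q q n * qInv q n = 1 :=
  mul_inv_cancel₀ (qPoch_self_ne_zero hq n)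

theorem tendsto_qPoch (a : ℂ) {q : ℂ} (hq : ‖q‖ < 1) :
    Tendsto (qPoch a q) atTop (𝓝 (qPochInf a q)) :=
  (multipliable_qPochInf a q hq).hasProd.tendsto_prod_nat

theorem one_sub_mul_pow_ne_zero {a q : ℂ} (ha : ‖a‖ < 1) (hq : ‖q‖ < 1) (n : ℕ) :
    1 - a * q ^ n ≠ 0 := by
  intro h
  have h1 : ‖a * q ^ n‖ < 1 := by
    rw [norm_mul, norm_pow]
    exact mul_lt_one_of_nonneg_of_lt_one_left (norm_nonneg _) ha
      (pow_le_one₀ (norm_nonneg q) hq.le)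
  rw [← sub_eq_zero.mp h, norm_one] at h1
  exact lt_irrefl _ h1

theorem qPochInf_ne_zero {a q : ℂ} (ha : ‖a‖ < 1) (hq : ‖q‖ < 1) : qPochInf a q ≠ 0 := by
  have h : Summable (fun k : ℕ => ‖-(a * q ^ k)‖) := by
    simpa [norm_mul, norm_pow] using
      (summable_geometric_of_lt_one (norm_nonneg q) hq).mul_left ‖a‖
  have := tprod_one_add_ne_zero_of_summable (f := fun k : ℕ => -(a * q ^ k))
    (fun k => by simpa [sub_eq_add_neg] using one_sub_mul_pow_ne_zero ha hq k) h
  simpa [qPochInf, sub_eq_add_neg] using this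

theorem exists_norm_qPoch_le {q : ℂ} (hq : ‖q‖ < 1) : ∃ C, 0 < C ∧ ∀ n, ‖qPoch q q n‖ ≤ C := by
  obtain ⟨C, hC⟩ := (tendsto_qPoch q hq).norm.bddAbove_range
  refine ⟨max C 1, by positivity, fun n => le_max_of_le_left (hC ⟨n, rfl⟩)⟩

theorem exists_norm_qInv_le {q : ℂ} (hq : ‖q‖ < 1) : ∃ C, 0 < C ∧ ∀ n, ‖qInv q n‖ ≤ C := by
  obtain ⟨C, hC⟩ := ((tendsto_qPoch q hq).inv₀ (qPochInf_ne_zero hq hq)).norm.bddAbove_range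
  refine ⟨max C 1, by positivity, fun n => le_max_of_le_left (hC ⟨n, rfl⟩)⟩

theorem summable_norm_qInv_mul_pow {q : ℂ} (hq : ‖q‖ < 1) {a : ℝ} (h0 : 0 ≤ a) (ha : a < 1) :
    Summable fun n => ‖qInv q n‖ * a ^ n := by
  obtain ⟨C, -, hC⟩ := exists_norm_qInv_le hq
  refine Summable.of_nonneg_of_le (fun n => by positivity) (fun n => ?_)
    ((summable_geometric_of_lt_one h0 ha).mul_left C)
  gcongr
  exact hC n

/-- A power series evaluated along `a q ^ N` tends to its constant term. -/
theorem tendsto_tsum_mul_pow {q : ℂ} (hq : ‖q‖ < 1) (a : ℂ) (c : ℕ → ℂ)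
    (hc : Summable fun n => ‖c n * a ^ n‖) :
    Tendsto (fun N : ℕ => ∑' n, c n * (a * q ^ N) ^ n) atTop (𝓝 (c 0)) := by
  have h0 : c 0 = ∑' n, if n = 0 then c 0 else 0 := by rw [tsum_ite_eq]
  rw [h0]
  refine tendsto_tsum_of_dominated_convergence hc (fun n => ?_) (Eventually.of_forall fun N n => ?_)
  · rcases Nat.eq_zero_or_pos n with rfl | hn
    · simp
    · have h1 : Tendsto (fun N : ℕ => a * q ^ N) atTop (𝓝 (a * 0)) :=
        (tendsto_pow_atTop_nhds_zero_of_norm_lt_one hq).const_mul a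
      have := (h1.pow n).const_mul (c n)
      simpa [hn.ne'] using this
  · rw [mul_pow, ← mul_assoc, norm_mul]
    refine mul_le_of_le_one_right (norm_nonneg _) ?_
    rw [norm_pow, norm_pow]
    exact pow_le_one₀ (by positivity) (pow_le_one₀ (norm_nonneg q) hq.le)

/-- Euler: `∑ a ^ n / (q; q)_n = 1 / (a; q)_∞`. -/
theorem tsum_qInv_mul_pow {q : ℂ} (hq : ‖q‖ < 1) {a : ℂ} (ha : ‖a‖ < 1) :
    ∑' n, qInv q n * a ^ n = (qPochInf a q)⁻¹ := by
  have hs : ∀ b : ℂ, ‖b‖ < 1 → Summable fun n => ‖qInv q n * b ^ n‖ := fun b hb => by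
    simpa [norm_mul, norm_pow] using summable_norm_qInv_mul_pow hq (norm_nonneg b) hb
  -- The functional equation f(bq) = (1 - b) f(b); iterating it pushes the argument to 0, where f is
  -- 1.
  have hstep : ∀ b : ℂ, ‖b‖ < 1 →
      (1 - b) * ∑' n, qInv q n * b ^ n = ∑' n, qInv q n * (b * q) ^ n := fun b hb => by
    have hbq : ‖b * q‖ < 1 := by
      rw [norm_mul]; exact mul_lt_one_of_nonneg_of_lt_one_left (norm_nonneg _) hb hq.le
    have h1 := (hs b hb).of_norm
    have h2 := (hs _ hbq).of_norm
    have : ∑' n, qInv q n * b ^ n - ∑' n, qInv q n * (b * q) ^ n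
        = b * ∑' n, qInv q n * b ^ n := by
      rw [← h1.tsum_sub h2, (h1.sub h2).tsum_eq_zero_add, ← tsum_mul_left]
      simp only [pow_zero, sub_self, zero_add]
      refine tsum_congr fun n => ?_
      rw [← qInv_succ hq n]; ring
    linear_combination this
  have hN : ∀ N : ℕ, ‖a * q ^ N‖ < 1 := fun N => by
    rw [norm_mul, norm_pow]
    exact mul_lt_one_of_nonneg_of_lt_one_left (norm_nonneg _) ha
      (pow_le_one₀ (norm_nonneg q) hq.le)
  have hiter : ∀ N : ℕ, qPoch a q N * ∑' n, qInv q n * a ^ n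
      = ∑' n, qInv q n * (a * q ^ N) ^ n := fun N => by
    induction N with
    | zero => simp [qPoch]
    | succ N ih =>
      have h := hstep _ (hN N)
      rw [← ih] at h
      rw [pow_succ, ← mul_assoc a, ← h, qPoch, qPoch, Finset.prod_range_succ]
      ring
  have h1 := (tendsto_qPoch a hq).mul_const (∑' n, qInv q n * a ^ n)
  have h2 := tendsto_tsum_mul_pow hq a _ (hs a ha)
  simp only [hiter] at h1
  have := tendsto_nhds_unique h1 h2
  rw [qInv_zero] at this
  exact eq_inv_of_mul_eq_one_right this

/-- The coefficients of the expansion of `(u; q)_∞`. -/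
noncomputable def eulerCoeff (q : ℂ) (k : ℕ) : ℂ := (-1) ^ k * q ^ k.choose 2 * qInv q k

/-- Ratio test on a majorant: its consecutive ratios are ‖q‖^k ‖u‖, which tend to 0 whatever u is.
-/
theorem summable_norm_eulerCoeff_mul_pow {q : ℂ} (hq : ‖q‖ < 1) (u : ℂ) :
    Summable fun k => ‖eulerCoeff q k * u ^ k‖ := by
  obtain ⟨C, hC0, hC⟩ := exists_norm_qInv_le hq
  have hb : ∀ k, ‖eulerCoeff q k * u ^ k‖ ≤ C * (‖q‖ ^ k.choose 2 * ‖u‖ ^ k) := fun k => by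
    simp only [eulerCoeff, norm_mul, norm_pow, norm_neg, norm_one, one_pow, one_mul]
    have := hC k
    calc ‖q‖ ^ k.choose 2 * ‖qInv q k‖ * ‖u‖ ^ k ≤ ‖q‖ ^ k.choose 2 * C * ‖u‖ ^ k := by gcongr
      _ = _ := by ring
  refine Summable.of_nonneg_of_le (fun _ => norm_nonneg _) hb (Summable.mul_left C ?_)
  have ht : Tendsto (fun k : ℕ => ‖q‖ ^ k * ‖u‖) atTop (𝓝 (0 * ‖u‖)) :=
    (tendsto_pow_atTop_nhds_zero_of_lt_one (norm_nonneg q) hq).mul_const _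
  rw [zero_mul] at ht
  refine summable_of_ratio_norm_eventually_le (r := 1 / 2) (by norm_num) ?_
  filter_upwards [ht.eventually (ge_mem_nhds (show (0 : ℝ) < 1 / 2 by norm_num))] with k hk
  rw [Nat.choose_succ_succ' k 1, Nat.choose_one_right, pow_add, pow_succ ‖u‖]
  have : ‖‖q‖ ^ k * ‖q‖ ^ k.choose (1 + 1) * (‖u‖ ^ k * ‖u‖)‖
      = (‖q‖ ^ k * ‖u‖) * ‖‖q‖ ^ k.choose 2 * ‖u‖ ^ k‖ := by
    rw [Real.norm_of_nonneg (by positivity), Real.norm_of_nonneg (by positivity)]; ring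
  rw [this]
  gcongr

/-- Euler: `∑ (-1) ^ k q ^ (k choose 2) u ^ k / (q; q)_k = (u; q)_∞`. -/
theorem tsum_eulerCoeff_mul_pow {q : ℂ} (hq : ‖q‖ < 1) (u : ℂ) :
    ∑' k, eulerCoeff q k * u ^ k = qPochInf u q := by
  have hs := fun b : ℂ => (summable_norm_eulerCoeff_mul_pow hq b).of_norm
  have hstep : ∀ b : ℂ, ∑' k, eulerCoeff q k * b ^ k
      = (1 - b) * ∑' k, eulerCoeff q k * (b * q) ^ k := fun b => by
    have : ∑' n, eulerCoeff q n * b ^ n - ∑' n, eulerCoeff q n * (b * q) ^ n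
        = -b * ∑' n, eulerCoeff q n * (b * q) ^ n := by
      rw [← (hs b).tsum_sub (hs _), ((hs b).sub (hs _)).tsum_eq_zero_add, ← tsum_mul_left]
      simp only [pow_zero, sub_self, zero_add]
      refine tsum_congr fun n => ?_
      simp only [eulerCoeff]
      rw [← qInv_succ hq n, Nat.choose_succ_succ' n 1, Nat.choose_one_right]
      ring
    linear_combination this
  have hiter : ∀ N : ℕ, ∑' n, eulerCoeff q n * u ^ n
      = qPoch u q N * ∑' n, eulerCoeff q n * (u * q ^ N) ^ n := fun N => by
    induction N with
    | zero => simp [qPoch]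
    | succ N ih =>
      rw [ih, hstep, pow_succ, ← mul_assoc u, qPoch, qPoch, Finset.prod_range_succ]
      ring
  have h1 := (tendsto_qPoch u hq).mul
    (tendsto_tsum_mul_pow hq u _ (summable_norm_eulerCoeff_mul_pow hq u))
  simp only [← hiter] at h1
  have := tendsto_nhds_unique tendsto_const_nhds h1
  rw [this]
  simp [eulerCoeff, qInv_zero]
-- Linearization of products of Rogers–Szegő polynomials.
open Finset

section Linearization

variable {A : Type*} [CommRing A] [Algebra ℂ A]

/-- The homogeneous Rogers–Szegő polynomial divided by `(q; q)_n`: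
`∑_{i + j = n} x ^ i y ^ j / ((q; q)_i (q; q)_j)`. -/
noncomputable def rogersSzego (q : ℂ) (x y : A) (n : ℕ) : A :=
  ∑ p ∈ antidiagonal n, (qInv q p.1 * qInv q p.2) • (x ^ p.1 * y ^ p.2)

theorem rogersSzego_zero (q : ℂ) (x y : A) : rogersSzego q x y 0 = 1 := by
  simp [rogersSzego, qInv_zero]

/-- The factor 1 - q^i kills the term i = 0 and turns 1/(q;q)_i into 1/(q;q)_(i-1), so the index
shifts by one. -/
theorem sum_antidiagonal_one_sub_pow_fst {q : ℂ} (hq : ‖q‖ < 1) (x : A) (f : ℕ → A) (n : ℕ) :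
    ∑ p ∈ antidiagonal (n + 1), ((1 - q ^ p.1) * qInv q p.1) • (x ^ p.1 * f p.2)
      = x * ∑ p ∈ antidiagonal n, qInv q p.1 • (x ^ p.1 * f p.2) := by
  rw [Nat.sum_antidiagonal_succ, mul_sum]
  simp only [pow_zero, sub_self, zero_mul, zero_smul, zero_add]
  refine sum_congr rfl fun p _ => ?_
  rw [qInv_succ hq, pow_succ', mul_assoc, mul_smul_comm]

theorem rogersSzego_swap (q : ℂ) (x y : A) (n : ℕ) : rogersSzego q x y n = rogersSzego q y x n := by
  rw [rogersSzego, rogersSzego, ← Nat.sum_antidiagonal_swap]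
  exact sum_congr rfl fun p _ => by
    simp only [Prod.fst_swap, Prod.snd_swap]; rw [mul_comm (qInv q _), mul_comm (x ^ _)]

theorem rogersSzego_fst {q : ℂ} (hq : ‖q‖ < 1) (x y : A) (n : ℕ) :
    ∑ p ∈ antidiagonal (n + 1), ((1 - q ^ p.1) * (qInv q p.1 * qInv q p.2)) • (x ^ p.1 * y ^ p.2)
      = x * rogersSzego q x y n := by
  have := sum_antidiagonal_one_sub_pow_fst hq x (fun j => qInv q j • y ^ j) n
  rw [rogersSzego]
  convert this using 2 with p hp
  · rw [mul_smul_comm, smul_smul, mul_assoc]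
  · refine sum_congr rfl fun p _ => ?_
    rw [mul_smul_comm, smul_smul]

theorem rogersSzego_snd {q : ℂ} (hq : ‖q‖ < 1) (x y : A) (n : ℕ) :
    ∑ p ∈ antidiagonal (n + 1), ((1 - q ^ p.2) * (qInv q p.1 * qInv q p.2)) • (x ^ p.1 * y ^ p.2)
      = y * rogersSzego q x y n := by
  rw [rogersSzego_swap, ← rogersSzego_fst hq, ← Nat.sum_antidiagonal_swap]
  exact sum_congr rfl fun p _ => by
    simp only [Prod.fst_swap, Prod.snd_swap]; rw [mul_comm (qInv q _), mul_comm (x ^ _)]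

theorem rogersSzego_fst_snd {q : ℂ} (hq : ‖q‖ < 1) (x y : A) (n : ℕ) :
    ∑ p ∈ antidiagonal (n + 2),
        ((1 - q ^ p.1) * (1 - q ^ p.2) * (qInv q p.1 * qInv q p.2)) • (x ^ p.1 * y ^ p.2)
      = x * y * rogersSzego q x y n := by
  have := sum_antidiagonal_one_sub_pow_fst hq x
    (fun j => ((1 - q ^ j) * qInv q j) • y ^ j) (n + 1)
  rw [mul_assoc, ← rogersSzego_snd hq]
  convert this using 2 with p hp
  · rw [mul_smul_comm, smul_smul]; congr 1; ring
  · refine sum_congr rfl fun p _ => ?_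
    rw [mul_smul_comm, smul_smul]; congr 1; ring

theorem rogersSzego_one {q : ℂ} (hq : ‖q‖ < 1) (x y : A) :
    (1 - q) • rogersSzego q x y 1 = x + y := by
  have := qInv_succ hq 0
  simp only [zero_add, pow_one, qInv_zero] at this
  simp [rogersSzego, qInv_zero, Nat.antidiagonal_succ, smul_smul, this, add_comm]

/-- Three-term recurrence: for i + j = n + 2, 1 - q^(i+j) = (1 - q^i) + (1 - q^j) - (1 - q^i)(1 -
q^j), and each piece lowers an index. -/
theorem rogersSzego_add_two {q : ℂ} (hq : ‖q‖ < 1) (x y : A) (n : ℕ) :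
    (1 - q ^ (n + 2)) • rogersSzego q x y (n + 2)
      = (x + y) * rogersSzego q x y (n + 1) - x * y * rogersSzego q x y n := by
  rw [add_mul, ← rogersSzego_fst hq, ← rogersSzego_snd hq, ← rogersSzego_fst_snd hq, rogersSzego,
    smul_sum, ← sum_add_distrib, ← sum_sub_distrib]
  refine sum_congr rfl fun p hp => ?_
  rw [smul_smul, ← add_smul, ← sub_smul, ← mem_antidiagonal.mp hp, pow_add]
  congr 1; ring

/-- `1 / (q; q)_i` extended by zero to negative `i`. -/
noncomputable def qInvInt (q : ℂ) (i : ℤ) : ℂ := if 0 ≤ i then qInv q i.toNat else 0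

theorem qInvInt_natCast (q : ℂ) (n : ℕ) : qInvInt q n = qInv q n := by simp [qInvInt]

theorem qInvInt_of_neg (q : ℂ) {i : ℤ} (hi : i < 0) : qInvInt q i = 0 := by
  simp [qInvInt, not_le.mpr hi]

/-- Extending by zero makes the lowering rule valid at every integer, so no boundary terms arise in
the linearization. -/
theorem qInvInt_sub_one {q : ℂ} (hq : ‖q‖ < 1) (i : ℤ) :
    qInvInt q (i - 1) = (1 - q ^ i.toNat) * qInvInt q i := by
  rcases lt_trichotomy i 0 with hi | rfl | hi
  · rw [qInvInt_of_neg q hi, qInvInt_of_neg q (by omega), mul_zero]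
  · simp [qInvInt]
  · obtain ⟨n, rfl⟩ : ∃ n : ℕ, i = n + 1 := ⟨(i - 1).toNat, by omega⟩
    have : ((n : ℤ) + 1).toNat = n + 1 := by omega
    rw [add_sub_cancel_right, qInvInt_natCast, this]
    rw [show ((n : ℤ) + 1) = ((n + 1 : ℕ) : ℤ) by push_cast; rfl, qInvInt_natCast, qInv_succ hq]

/-- The Rogers–Szegő polynomial `(q; q)_i * rogersSzego q x y i`, zero for negative `i`. -/
noncomputable def rogersSzegoInt (q : ℂ) (x y : A) (i : ℤ) : A :=
  if 0 ≤ i then qPoch q q i.toNat • rogersSzego q x y i.toNat else 0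

theorem rogersSzegoInt_natCast (q : ℂ) (x y : A) (n : ℕ) :
    rogersSzegoInt q x y n = qPoch q q n • rogersSzego q x y n := by simp [rogersSzegoInt]

theorem add_mul_rogersSzegoInt {q : ℂ} (hq : ‖q‖ < 1) (x y : A) {i : ℤ} (hi : 0 ≤ i) :
    (x + y) * rogersSzegoInt q x y i = rogersSzegoInt q x y (i + 1)
      + x * y * ((1 - q ^ i.toNat) • rogersSzegoInt q x y (i - 1)) := by
  obtain ⟨n, rfl⟩ := Int.eq_ofNat_of_zero_le hi
  rcases n with _ | n
  · have h1 := rogersSzego_one hq x y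
    have h2 : rogersSzegoInt q x y 1 = qPoch q q 1 • rogersSzego q x y 1 :=
      rogersSzegoInt_natCast q x y 1
    have h0 : rogersSzegoInt q x y 0 = qPoch q q 0 • rogersSzego q x y 0 :=
      rogersSzegoInt_natCast q x y 0
    simp [h2, h0, rogersSzego_zero, qPoch_self_succ, qPoch_zero, h1]
  · have h := rogersSzego_add_two hq x y n
    rw [show ((n + 1 : ℕ) : ℤ) + 1 = ((n + 2 : ℕ) : ℤ) by push_cast; ring,
      show ((n + 1 : ℕ) : ℤ) - 1 = (n : ℤ) by push_cast; ring, rogersSzegoInt_natCast,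
      rogersSzegoInt_natCast, rogersSzegoInt_natCast, Int.toNat_natCast,
      qPoch_self_succ q (n + 1), mul_smul, h, smul_smul, qPoch_self_succ q n, smul_sub]
    simp only [mul_smul_comm]
    rw [mul_comm (qPoch q q n) (1 - _)]
    abel

/-- The right-hand side of the linearization formula, with integer first index. -/
noncomputable def linearizationSum (q : ℂ) (x y : A) (m : ℤ) (n : ℕ) : A :=
  ∑ k ∈ range (n + 1), (qInv q k * qInvInt q (m - k) * qInvInt q (n - k)) •
    ((x * y) ^ k * rogersSzegoInt q x y (m + n - 2 * k))

theorem linearizationSum_eq_sum_range_add_two (q : ℂ) (x y : A) (m : ℤ) (n : ℕ) :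
    linearizationSum q x y m n =
      ∑ k ∈ range (n + 2), (qInv q k * qInvInt q (m - k) * qInvInt q (n - k)) •
        ((x * y) ^ k * rogersSzegoInt q x y (m + n - 2 * k)) := by
  rw [sum_range_succ, qInvInt_of_neg q (i := (n : ℤ) - (n + 1 : ℕ)) (by push_cast; omega)]
  simp [linearizationSum]

/-- With u = q^k, v = q^(m+1-k), w = q^(n+1-k), a common factor drops out and leaves (1-v)(1-w) +
(1-u)(1-vw) = (1-uv)(1-w) + (1-u)(1-v). -/
theorem linearization_coeff {q : ℂ} (hq : ‖q‖ < 1) (m : ℤ) (n k : ℕ) :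
    qInv q k * qInvInt q (m - k) * qInvInt q (n - k)
      + qInvInt q (k - 1) * qInvInt q (m + 1 - k) * qInvInt q (n + 1 - k)
          * (1 - q ^ (m + n + 2 - 2 * k).toNat)
    = (1 - q ^ (m + 1).toNat) * (qInv q k * qInvInt q (m + 1 - k) * qInvInt q (n - k))
      + qInvInt q (k - 1) * qInvInt q (m - k) * qInvInt q (n + 1 - k) := by
  have e1 := qInvInt_sub_one hq (m + 1 - k)
  have e2 := qInvInt_sub_one hq (n + 1 - k)
  rw [show m + 1 - (k : ℤ) - 1 = m - k by ring] at e1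
  rw [show (n : ℤ) + 1 - (k : ℤ) - 1 = n - k by ring] at e2
  have e3 := qInvInt_sub_one hq k
  rw [qInvInt_natCast, Int.toNat_natCast] at e3
  rw [e1, e2, e3]
  rcases lt_or_ge (m + 1 - k) 0 with h | h
  · simp [qInvInt_of_neg q h]
  rcases lt_or_ge ((n : ℤ) + 1 - k) 0 with h' | h'
  · simp [qInvInt_of_neg q h']
  rw [show (m + 1).toNat = k + (m + 1 - k).toNat by omega,
    show (m + n + 2 - 2 * k).toNat = (m + 1 - k).toNat + ((n : ℤ) + 1 - k).toNat by omega,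
    pow_add, pow_add]
  ring

/-- The recurrence in m satisfied by h_m h_n for fixed n. The three-term recurrence is applied to
each summand, k is shifted in the lowered part, and coefficients of (xy)^k h_(m+n+1-2k) are
compared. -/
theorem linearizationSum_succ {q : ℂ} (hq : ‖q‖ < 1) (x y : A) (m : ℤ) (n : ℕ) :
    (x + y) * linearizationSum q x y m n
      = (1 - q ^ (m + 1).toNat) • linearizationSum q x y (m + 1) n
        + x * y * linearizationSum q x y (m - 1) n := by
  have hl : (x + y) * linearizationSum q x y m n
      = ∑ k ∈ range (n + 2), ((qInv q k * qInvInt q (m - k) * qInvInt q (n - k)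
      + qInvInt q (k - 1) * qInvInt q (m + 1 - k) * qInvInt q (n + 1 - k)
          * (1 - q ^ (m + n + 2 - 2 * k).toNat))) •
          ((x * y) ^ k * rogersSzegoInt q x y (m + n + 1 - 2 * k)) := by
    have h1 : (x + y) * linearizationSum q x y m n
        = ∑ k ∈ range (n + 1), ((qInv q k * qInvInt q (m - k) * qInvInt q (n - k)) •
            ((x * y) ^ k * rogersSzegoInt q x y (m + n + 1 - 2 * k))
          + (qInv q k * qInvInt q (m - k) * qInvInt q (n - k)
              * (1 - q ^ (m + n - 2 * k).toNat)) •
            ((x * y) ^ (k + 1) * rogersSzegoInt q x y (m + n - 1 - 2 * k))) := by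
      rw [linearizationSum, mul_sum]
      refine sum_congr rfl fun k hk => ?_
      rcases lt_or_ge (m - k) 0 with h | h
      · simp [qInvInt_of_neg q h]
      have hk' := mem_range.mp hk
      rw [mul_smul_comm, mul_left_comm, add_mul_rogersSzegoInt hq x y (by omega),
        show m + n - 2 * k + 1 = m + n + 1 - 2 * (k : ℤ) by ring,
        show m + n - 2 * k - 1 = m + n - 1 - 2 * (k : ℤ) by ring, mul_add, smul_add,
        mul_smul_comm, mul_smul_comm, smul_smul, pow_succ, mul_assoc ((x * y) ^ k)]
    simp only [add_smul]
    rw [h1, sum_add_distrib, sum_add_distrib]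
    congr 1
    · rw [sum_range_succ _ (n + 1),
        qInvInt_of_neg q (i := (n : ℤ) - (n + 1 : ℕ)) (by push_cast; omega)]
      simp
    · rw [sum_range_succ' _ (n + 1)]
      have : qInvInt q (((0 : ℕ) : ℤ) - 1) = 0 := qInvInt_of_neg q (by simp)
      rw [this]
      simp only [zero_mul, zero_smul, add_zero]
      refine sum_congr rfl fun k _ => ?_
      rw [show ((k + 1 : ℕ) : ℤ) - 1 = k by push_cast; ring, qInvInt_natCast,
        show m + 1 - ((k + 1 : ℕ) : ℤ) = m - k by push_cast; ring,
        show (n : ℤ) + 1 - ((k + 1 : ℕ) : ℤ) = n - k by push_cast; ring,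
        show m + n + 2 - 2 * ((k + 1 : ℕ) : ℤ) = m + n - 2 * k by push_cast; ring,
        show m + n + 1 - 2 * ((k + 1 : ℕ) : ℤ) = m + n - 1 - 2 * k by push_cast; ring]
  have hr : x * y * linearizationSum q x y (m - 1) n
      = ∑ k ∈ range (n + 2), (qInvInt q (k - 1) * qInvInt q (m - k) * qInvInt q (n + 1 - k)) •
          ((x * y) ^ k * rogersSzegoInt q x y (m + n + 1 - 2 * k)) := by
    rw [sum_range_succ' _ (n + 1)]
    have : qInvInt q (((0 : ℕ) : ℤ) - 1) = 0 := qInvInt_of_neg q (by simp)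
    rw [this]
    simp only [zero_mul, zero_smul, add_zero]
    rw [linearizationSum, mul_sum]
    refine sum_congr rfl fun k _ => ?_
    rw [show ((k + 1 : ℕ) : ℤ) - 1 = k by push_cast; ring, qInvInt_natCast,
        show m - ((k + 1 : ℕ) : ℤ) = m - 1 - k by push_cast; ring,
        show (n : ℤ) + 1 - ((k + 1 : ℕ) : ℤ) = n - k by push_cast; ring,
        show m + n + 1 - 2 * ((k + 1 : ℕ) : ℤ) = m - 1 + n - 2 * k by push_cast; ring,
        mul_smul_comm, pow_succ', mul_assoc (x * y)]
  rw [hl, hr, linearizationSum_eq_sum_range_add_two, smul_sum, ← sum_add_distrib]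
  refine sum_congr rfl fun k _ => ?_
  rw [linearization_coeff hq, add_smul, smul_smul,
    show m + 1 + n - 2 * (k : ℤ) = m + n + 1 - 2 * k by ring]

theorem linearizationSum_of_neg (q : ℂ) (x y : A) {m : ℤ} (hm : m < 0) (n : ℕ) :
    linearizationSum q x y m n = 0 := by
  refine sum_eq_zero fun k _ => ?_
  rw [qInvInt_of_neg q (i := m - k) (by omega)]
  simp

/-- Both sides satisfy the same second-order recurrence in m and agree at m = 0. The case m = 1
follows because the sum vanishes at m = -1. -/
theorem rogersSzego_mul_eq_linearizationSum {q : ℂ} (hq : ‖q‖ < 1) (x y : A) (m n : ℕ) :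
    rogersSzego q x y m * rogersSzego q x y n = linearizationSum q x y m n := by
  have h0 : rogersSzego q x y 0 * rogersSzego q x y n = linearizationSum q x y (0 : ℕ) n := by
    rw [rogersSzego_zero, one_mul, linearizationSum, sum_range_succ', sum_eq_zero]
    · have := rogersSzegoInt_natCast q x y n
      have h2 := qInvInt_natCast q n
      have h3 := qInvInt_natCast q 0
      simp only [CharP.cast_eq_zero] at h3
      simp [qInv_zero, this, h2, h3, smul_smul, mul_comm (qInv q n), qPoch_mul_qInv hq]
    · intro k _
      rw [qInvInt_of_neg q (i := ((0 : ℕ) : ℤ) - (k + 1 : ℕ)) (by push_cast; omega)]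
      simp
  have key : ∀ m : ℕ, rogersSzego q x y m * rogersSzego q x y n = linearizationSum q x y m n ∧
      rogersSzego q x y (m + 1) * rogersSzego q x y n
        = linearizationSum q x y (m + 1 : ℕ) n := by
    intro m
    induction m with
    | zero =>
      refine ⟨h0, ?_⟩
      have h := linearizationSum_succ hq x y ((0 : ℕ) : ℤ) n
      rw [linearizationSum_of_neg q x y (m := ((0 : ℕ) : ℤ) - 1) (by simp), mul_zero, add_zero, ← h0, rogersSzego_zero,
        one_mul, ← rogersSzego_one hq, smul_mul_assoc] at h
      have hne : (1 - q) ≠ 0 := by simpa using one_sub_pow_ne_zero hq 0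
      exact smul_right_injective A hne (by simpa using h)
    | succ m ih =>
      refine ⟨ih.2, ?_⟩
      have h := linearizationSum_succ hq x y ((m + 1 : ℕ) : ℤ) n
      rw [show ((m + 1 : ℕ) : ℤ) + 1 = (m + 2 : ℕ) by push_cast; ring,
        show ((m + 1 : ℕ) : ℤ) - 1 = (m : ℕ) by push_cast; ring, ← ih.1, ← ih.2,
        Int.toNat_natCast] at h
      refine smul_right_injective A (one_sub_pow_ne_zero hq (m + 1)) ?_
      simp only
      rw [← sub_eq_iff_eq_add] at h
      rw [← smul_mul_assoc, rogersSzego_add_two hq, ← h, sub_mul, mul_assoc, mul_assoc (x * y)]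
  exact (key m).1

/-- Linearization of products of Rogers–Szegő polynomials. -/
theorem rogersSzego_mul {q : ℂ} (hq : ‖q‖ < 1) (x y : A) (m n : ℕ) :
    rogersSzego q x y m * rogersSzego q x y n =
      ∑ k ∈ range (min m n + 1),
        (qInv q k * (qInv q (m - k) * qInv q (n - k) * qPoch q q (m - k + (n - k)))) •
          ((x * y) ^ k * rogersSzego q x y (m - k + (n - k))) := by
  rw [rogersSzego_mul_eq_linearizationSum hq, linearizationSum]
  symm
  have hsub : range (min m n + 1) ⊆ range (n + 1) := range_mono (by omega)
  rw [← sum_subset hsub]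
  · refine sum_congr rfl fun k hk => ?_
    have hk' := mem_range.mp hk
    rw [show (m : ℤ) - k = (m - k : ℕ) by omega, show (n : ℤ) - k = (n - k : ℕ) by omega,
      show (m : ℤ) + n - 2 * k = (m - k + (n - k) : ℕ) by omega, qInvInt_natCast,
      qInvInt_natCast, rogersSzegoInt_natCast, mul_smul_comm, smul_smul]
    congr 1; ring
  · intro k hk hk'
    rw [mem_range] at hk hk'
    rw [qInvInt_of_neg q (i := (m : ℤ) - k) (by omega)]
    simp

end Linearization
-- Reindexing sums over k ≤ min(m, n) as free triple sums.
open Finset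

section Reindexing

variable {A : Type*} [NormedAddCommGroup A]

/-- Triples `(k, i, j)` correspond to pairs `(m, n) = (i + k, j + k)` with `k ≤ min m n`. -/
def sigmaFinMinEquiv : (Σ p : ℕ × ℕ, Fin (min p.1 p.2 + 1)) ≃ ℕ × (ℕ × ℕ) where
  toFun s := (s.2, (s.1.1 - s.2, s.1.2 - s.2))
  invFun t := ⟨(t.2.1 + t.1, t.2.2 + t.1), ⟨t.1, by simp⟩⟩
  left_inv := by
    rintro ⟨⟨m, n⟩, ⟨k, hk⟩⟩
    have h1 : m - k + k = m := by simp only at hk; omega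
    have h2 : n - k + k = n := by simp only at hk; omega
    rw [Sigma.mk.injEq]
    refine ⟨by simp [h1, h2], ?_⟩
    rw [Fin.heq_ext_iff]
    simp [h1, h2]
  right_inv := by rintro ⟨k, i, j⟩; simp

theorem summable_norm_sum_range_min {F : ℕ × (ℕ × ℕ) → A} (hF : Summable fun t => ‖F t‖) :
    Summable fun p : ℕ × ℕ =>
      ‖∑ k ∈ range (min p.1 p.2 + 1), F (k, (p.1 - k, p.2 - k))‖ := by
  have h := (sigmaFinMinEquiv.summable_iff.mpr hF).sigma
  refine Summable.of_nonneg_of_le (fun _ => norm_nonneg _) (fun p => ?_) h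
  rw [tsum_fintype, Finset.sum_range]
  exact norm_sum_le _ _

theorem hasSum_sum_range_min [CompleteSpace A] {F : ℕ × (ℕ × ℕ) → A}
    (hF : Summable fun t => ‖F t‖) :
    HasSum (fun p : ℕ × ℕ => ∑ k ∈ range (min p.1 p.2 + 1), F (k, (p.1 - k, p.2 - k)))
      (∑' t, F t) := by
  have h := sigmaFinMinEquiv.hasSum_iff.mpr hF.of_norm.hasSum
  have h2 := h.sigma (fun p => hasSum_fintype _)
  convert h2 using 2 with p
  rw [Finset.sum_range]
  rfl

end Reindexing

/-! ### The q-Mehler formula and the generating function of the 2D q-Hermite polynomials. -/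

section GeneratingFunctions

variable {A : Type*} [NormedCommRing A] [NormedAlgebra ℂ A]

/-- Euler's series `∑ u ^ n / (q; q)_n`. -/
noncomputable def eulerSeries (q : ℂ) (u : A) : A := ∑' n, qInv q n • u ^ n

theorem summable_norm_qInv_smul_pow [NormOneClass A] {q : ℂ} (hq : ‖q‖ < 1) {u : A} (hu : ‖u‖ < 1) :
    Summable fun n => ‖qInv q n • u ^ n‖ := by
  refine Summable.of_nonneg_of_le (fun _ => norm_nonneg _) (fun n => ?_)
    (summable_norm_qInv_mul_pow hq (norm_nonneg u) hu)
  rw [norm_smul]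
  gcongr
  exact norm_pow_le u n

theorem eulerSeries_eq_inv {q : ℂ} (hq : ‖q‖ < 1) {a : ℂ} (ha : ‖a‖ < 1) :
    eulerSeries q a = (qPochInf a q)⁻¹ := by
  simpa [eulerSeries] using tsum_qInv_mul_pow hq ha

theorem norm_smul_lt_one {a : ℂ} (ha : ‖a‖ < 1) {x : A} (hx : ‖x‖ ≤ 1) : ‖a • x‖ < 1 := by
  rw [norm_smul]
  exact mul_lt_one_of_nonneg_of_lt_one_left (norm_nonneg a) ha hx

theorem pow_smul_rogersSzego (q : ℂ) (a : ℂ) (x y : A) (n : ℕ) :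
    a ^ n • rogersSzego q x y n = ∑ p ∈ antidiagonal n,
      (qInv q p.1 • (a • x) ^ p.1) * (qInv q p.2 • (a • y) ^ p.2) := by
  rw [rogersSzego, smul_sum]
  refine sum_congr rfl fun p hp => ?_
  rw [← mem_antidiagonal.mp hp, smul_pow, smul_pow, smul_mul_smul_comm, smul_mul_smul_comm,
    smul_smul, smul_smul, pow_add]
  congr 1; ring

theorem summable_norm_pow_smul_rogersSzego [NormOneClass A] {q : ℂ} (hq : ‖q‖ < 1) {a : ℂ} (ha : ‖a‖ < 1)
    {x y : A} (hx : ‖x‖ ≤ 1) (hy : ‖y‖ ≤ 1) :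
    Summable fun n => ‖a ^ n • rogersSzego q x y n‖ := by
  have h := summable_norm_sum_mul_antidiagonal_of_summable_norm
    (summable_norm_qInv_smul_pow hq (norm_smul_lt_one ha hx))
    (summable_norm_qInv_smul_pow hq (norm_smul_lt_one ha hy))
  exact h.congr fun n => congrArg norm (pow_smul_rogersSzego q a x y n).symm

theorem tsum_pow_smul_rogersSzego [NormOneClass A] [CompleteSpace A] {q : ℂ} (hq : ‖q‖ < 1) {a : ℂ} (ha : ‖a‖ < 1)
    {x y : A} (hx : ‖x‖ ≤ 1) (hy : ‖y‖ ≤ 1) :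
    ∑' n, a ^ n • rogersSzego q x y n = eulerSeries q (a • x) * eulerSeries q (a • y) := by
  have h := tsum_mul_tsum_eq_tsum_sum_antidiagonal_of_summable_norm
    (summable_norm_qInv_smul_pow hq (norm_smul_lt_one ha hx))
    (summable_norm_qInv_smul_pow hq (norm_smul_lt_one ha hy))
  rw [eulerSeries, eulerSeries, h]
  exact tsum_congr fun n => pow_smul_rogersSzego q a x y n

/-- The coefficients `(q; q)_{m+n} a ^ m b ^ n / ((q; q)_m (q; q)_n)`. -/
noncomputable def mehlerCoeff (q a b : ℂ) (p : ℕ × ℕ) : ℂ :=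
  qInv q p.1 * qInv q p.2 * qPoch q q (p.1 + p.2) * (a ^ p.1 * b ^ p.2)

theorem norm_rogersSzego_le [NormOneClass A] {q : ℂ} {C : ℝ} (hC : ∀ n, ‖qInv q n‖ ≤ C)
    {x y : A} (hx : ‖x‖ ≤ 1) (hy : ‖y‖ ≤ 1) (n : ℕ) :
    ‖rogersSzego q x y n‖ ≤ (n + 1) * C ^ 2 := by
  have hC0 : 0 ≤ C := (norm_nonneg _).trans (hC 0)
  refine (norm_sum_le_of_le (f := fun p : ℕ × ℕ => (qInv q p.1 * qInv q p.2) •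
    (x ^ p.1 * y ^ p.2)) _ (n := fun _ => C ^ 2) fun p _ => ?_).trans ?_
  · rw [norm_smul, norm_mul, sq, ← mul_one (C * C)]
    gcongr
    · exact hC _
    · exact hC _
    · calc ‖x ^ p.1 * y ^ p.2‖ ≤ ‖x‖ ^ p.1 * ‖y‖ ^ p.2 :=
          (norm_mul_le _ _).trans (by gcongr <;> exact norm_pow_le _ _)
        _ ≤ 1 * 1 := by
          gcongr
          · exact pow_le_one₀ (norm_nonneg x) hx
          · exact pow_le_one₀ (norm_nonneg y) hy
        _ = 1 := one_mul 1
  · simp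

/-- The polynomials grow at most linearly in their index, and m + n + 1 ≤ (m + 1)(n + 1) decouples
the double series. -/
theorem summable_norm_mehler [NormOneClass A] {q : ℂ} (hq : ‖q‖ < 1) {a b : ℂ} (ha : ‖a‖ < 1) (hb : ‖b‖ < 1)
    {x y : A} (hx : ‖x‖ ≤ 1) (hy : ‖y‖ ≤ 1) :
    Summable fun p : ℕ × ℕ => ‖mehlerCoeff q a b p • rogersSzego q x y (p.1 + p.2)‖ := by
  obtain ⟨C, hC0, hC⟩ := exists_norm_qInv_le hq
  obtain ⟨D, hD0, hD⟩ := exists_norm_qPoch_le hq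
  have hs : ∀ a : ℂ, ‖a‖ < 1 → Summable fun n : ℕ => ((n : ℝ) + 1) * ‖a‖ ^ n := fun a ha => by
    have h1 := summable_pow_mul_geometric_of_norm_lt_one (R := ℝ) 1 (r := ‖a‖) (by simpa using ha)
    have h2 := summable_geometric_of_lt_one (norm_nonneg a) ha
    simpa [add_mul] using h1.add h2
  have hprod := ((hs a ha).mul_of_nonneg (hs b hb) (fun _ => by positivity)
    (fun _ => by positivity)).mul_left (C ^ 2 * D * C ^ 2)
  refine Summable.of_nonneg_of_le (fun _ => norm_nonneg _) (fun p => ?_) hprod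
  obtain ⟨m, n⟩ := p
  simp only [mehlerCoeff, norm_smul, norm_mul, norm_pow]
  have hg := norm_rogersSzego_le hC hx hy (m + n)
  calc ‖qInv q m‖ * ‖qInv q n‖ * ‖qPoch q q (m + n)‖ * (‖a‖ ^ m * ‖b‖ ^ n)
        * ‖rogersSzego q x y (m + n)‖
      ≤ C * C * D * (‖a‖ ^ m * ‖b‖ ^ n) * (((m + n : ℕ) + 1) * C ^ 2) := by
        gcongr
        · exact hC m
        · exact hC n
        · exact hD _
    _ ≤ C * C * D * (‖a‖ ^ m * ‖b‖ ^ n) * ((((m : ℝ) + 1) * (n + 1)) * C ^ 2) := by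
        gcongr
        push_cast
        nlinarith [mul_nonneg (Nat.cast_nonneg (α := ℝ) m) (Nat.cast_nonneg (α := ℝ) n)]
    _ = _ := by ring

/-- Carlitz's form of the `q`-Mehler formula. -/
theorem eulerSeries_smul_tsum_mehler [NormOneClass A] [CompleteSpace A] {q : ℂ} (hq : ‖q‖ < 1) {a b : ℂ}
    (ha : ‖a‖ < 1) (hb : ‖b‖ < 1) {x y : A} (hx : ‖x‖ ≤ 1) (hy : ‖y‖ ≤ 1) {t : ℂ} (ht : ‖t‖ ≤ 1)
    (hxy : x * y = algebraMap ℂ A t) :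
    eulerSeries q (a * b * t) • ∑' p : ℕ × ℕ, mehlerCoeff q a b p • rogersSzego q x y (p.1 + p.2)
      = eulerSeries q (a • x) * eulerSeries q (a • y)
        * (eulerSeries q (b • x) * eulerSeries q (b • y)) := by
  have habt : ‖a * b * t‖ < 1 := by
    rw [norm_mul, norm_mul]
    exact mul_lt_one_of_nonneg_of_lt_one_left (by positivity)
      (mul_lt_one_of_nonneg_of_lt_one_left (by positivity) ha hb.le) ht
  have hA := summable_norm_pow_smul_rogersSzego hq ha hx hy
  have hB := summable_norm_pow_smul_rogersSzego hq hb hx hy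
  rw [← tsum_pow_smul_rogersSzego hq ha hx hy, ← tsum_pow_smul_rogersSzego hq hb hx hy,
    tsum_mul_tsum_of_summable_norm hA hB]
  have hk : Summable fun k => ‖(qInv q k • (a * b * t) ^ k) • (1 : A)‖ := by
    simpa only [norm_smul, norm_one, mul_one] using summable_norm_qInv_smul_pow hq habt
  have hG := summable_norm_mehler hq ha hb hx hy
  -- Linearizing h_m h_n gives a triple sum over k, m - k, n - k. Since xy is the scalar t, the sum
  -- over k splits off as an Euler series in abt.
  have hsum := hasSum_sum_range_min (hk.mul_norm hG)
  rw [← tsum_mul_tsum_of_summable_norm hk hG,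
    (summable_norm_qInv_smul_pow hq habt).of_norm.tsum_smul_const, smul_one_mul] at hsum
  rw [eulerSeries, ← hsum.tsum_eq]
  refine tsum_congr fun p => ?_
  obtain ⟨m, n⟩ := p
  simp only
  rw [smul_mul_smul_comm, rogersSzego_mul hq, smul_sum]
  refine sum_congr rfl fun k hk => ?_
  have hk' := mem_range.mp hk
  obtain ⟨i, rfl⟩ := Nat.exists_eq_add_of_le (show k ≤ m by omega)
  obtain ⟨j, rfl⟩ := Nat.exists_eq_add_of_le (show k ≤ n by omega)
  rw [hxy, ← map_pow, ← Algebra.smul_def, smul_one_mul, smul_smul, smul_smul, smul_smul,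
    mehlerCoeff, smul_eq_mul]
  simp only [Nat.add_sub_cancel_left]
  congr 1; ring

/-- The terms of the generating function of the 2D `q`-Hermite polynomials. -/
noncomputable def qHermiteTerm (q z₁ z₂ r s : ℂ) (p : ℕ × ℕ) : ℂ :=
  qHermite2D p.1 p.2 z₁ z₂ q * qInv q p.1 * qInv q p.2 * (r ^ p.1 * s ^ p.2)

/-- Since xy = 1, x^m y^n = x^(m-k) y^(n-k). Each term is thus a slice of a product of three
independent Euler-type series, in k, m - k and n - k. -/
theorem qHermiteTerm_smul {q : ℂ} (hq : ‖q‖ < 1) (z₁ z₂ r s : ℂ) {x y : A} (hxy : x * y = 1)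
    (p : ℕ × ℕ) :
    qHermiteTerm q z₁ z₂ r s p • (x ^ p.1 * y ^ p.2) =
      ∑ k ∈ range (min p.1 p.2 + 1), ((eulerCoeff q k * (r * s) ^ k) • (1 : A)) *
        ((qInv q (p.1 - k) • ((r * z₁) • x) ^ (p.1 - k)) *
          (qInv q (p.2 - k) • ((s * z₂) • y) ^ (p.2 - k))) := by
  obtain ⟨m, n⟩ := p
  simp only
  have h : qHermiteTerm q z₁ z₂ r s (m, n) = ∑ k ∈ range (min m n + 1),
      ((-1) ^ k * q ^ (k.choose 2) * z₁ ^ (m - k) * z₂ ^ (n - k) /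
        (qPoch q q (m - k) * qPoch q q (n - k) * qPoch q q k)) * (r ^ m * s ^ n) := by
    rw [← sum_mul, qHermiteTerm, qHermite2D]
    have h1 := qPoch_mul_qInv hq m
    have h2 := qPoch_mul_qInv hq n
    simp only
    generalize ∑ k ∈ range (min m n + 1), (_ : ℂ) = S
    linear_combination (r ^ m * s ^ n * S) * (qPoch q q n * qInv q n) * h1
      + (r ^ m * s ^ n * S) * h2
  rw [h, sum_smul]
  refine sum_congr rfl fun k hk => ?_
  have hk' := mem_range.mp hk
  obtain ⟨i, rfl⟩ := Nat.exists_eq_add_of_le (show k ≤ m by omega)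
  obtain ⟨j, rfl⟩ := Nat.exists_eq_add_of_le (show k ≤ n by omega)
  simp only [Nat.add_sub_cancel_left]
  have hx : x ^ (k + i) * y ^ (k + j) = x ^ i * y ^ j := by
    calc x ^ (k + i) * y ^ (k + j) = (x * y) ^ k * (x ^ i * y ^ j) := by ring
      _ = _ := by rw [hxy, one_pow, one_mul]
  rw [hx, smul_one_mul, smul_pow, smul_pow, smul_smul, smul_smul, smul_mul_smul_comm, smul_smul,
    eulerCoeff, qInv, qInv, qInv, div_eq_mul_inv, mul_inv, mul_inv]
  congr 1; ring

theorem qHermite_generating [NormOneClass A] [CompleteSpace A] {q : ℂ} (hq : ‖q‖ < 1) {z₁ z₂ r s : ℂ}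
    (h₁ : ‖r * z₁‖ < 1) (h₂ : ‖s * z₂‖ < 1) {x y : A} (hx : ‖x‖ ≤ 1) (hy : ‖y‖ ≤ 1)
    (hxy : x * y = 1) :
    (Summable fun p : ℕ × ℕ => ‖qHermiteTerm q z₁ z₂ r s p • (x ^ p.1 * y ^ p.2)‖) ∧
    HasSum (fun p : ℕ × ℕ => qHermiteTerm q z₁ z₂ r s p • (x ^ p.1 * y ^ p.2))
      (qPochInf (r * s) q • (eulerSeries q ((r * z₁) • x) * eulerSeries q ((s * z₂) • y))) := by
  have hk : Summable fun k => ‖(eulerCoeff q k * (r * s) ^ k) • (1 : A)‖ := by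
    simpa only [norm_smul, norm_one, mul_one] using summable_norm_eulerCoeff_mul_pow hq (r * s)
  have hi := summable_norm_qInv_smul_pow hq (norm_smul_lt_one h₁ hx)
  have hj := summable_norm_qInv_smul_pow hq (norm_smul_lt_one h₂ hy)
  have hij := hi.mul_norm hj
  have hF := hk.mul_norm hij
  have hterm := funext (qHermiteTerm_smul hq z₁ z₂ r s hxy)
  have hsum := summable_norm_sum_range_min hF
  have h := hasSum_sum_range_min hF
  rw [← tsum_mul_tsum_of_summable_norm hk hij, ← tsum_mul_tsum_of_summable_norm hi hj,
    (summable_norm_eulerCoeff_mul_pow hq (r * s)).of_norm.tsum_smul_const, smul_one_mul,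
    tsum_eulerCoeff_mul_pow hq] at h
  rw [eulerSeries, eulerSeries, hterm]
  exact ⟨hsum.congr fun p => congrArg norm (congrFun hterm p).symm, h⟩

end GeneratingFunctions
-- The theta weight and its moments.
open Finset

section Weight

theorem choose_add_one_two (M : ℤ) : Ring.choose (M + 1) 2 = M + Ring.choose M 2 := by
  rw [Ring.choose_succ_succ M 1, Ring.choose_one_right]

theorem two_mul_choose_two (M : ℤ) : 2 * Ring.choose M 2 = M * (M - 1) := by
  induction M using Int.induction_on with
  | zero => simp [Ring.choose_zero_pos ℤ (k := 2) (by norm_num)]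
  | succ n ih => rw [choose_add_one_two, mul_add, ih]; ring
  | pred n ih =>
    have := choose_add_one_two (-n - 1)
    rw [sub_add_cancel] at this
    linarith

theorem choose_two_nonneg (M : ℤ) : 0 ≤ Ring.choose M 2 := by
  have h := two_mul_choose_two M
  rcases le_or_gt M 0 with hM | hM <;> nlinarith

/-- The natural number `M (M - 1) / 2`. -/
noncomputable def triangle (M : ℤ) : ℕ := (Ring.choose M 2).toNat

theorem triangle_cast (M : ℤ) : (triangle M : ℤ) = Ring.choose M 2 :=
  Int.toNat_of_nonneg (choose_two_nonneg M)

theorem zpow_choose_two (q : ℂ) (M : ℤ) : q ^ Ring.choose M 2 = q ^ triangle M := by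
  rw [← triangle_cast, zpow_natCast]

theorem triangle_add_one (M : ℤ) : (triangle (M + 1) : ℤ) = M + triangle M := by
  rw [triangle_cast, triangle_cast, choose_add_one_two]

/-- A linear bound is enough to dominate the weights by a geometric series. -/
theorem natAbs_sub_one_le_triangle (M : ℤ) : M.natAbs - 1 ≤ triangle M := by
  have h := two_mul_choose_two M
  rw [← triangle_cast] at h
  rcases le_or_gt M 0 with hM | hM
  · have : (-M) ≤ triangle M := by nlinarith
    omega
  · have : M - 1 ≤ triangle M := by
      rcases eq_or_lt_of_le (show 1 ≤ M by omega) with rfl | h2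
      · omega
      · nlinarith
    omega

theorem qWeight_eq (q : ℂ) (M : ℤ) :
    qWeight q M = (-1) ^ M * (q ^ triangle M + q ^ triangle (-M)) := by
  rw [qWeight, zpow_choose_two, zpow_choose_two]

/-- The alternating `q`-binomial sum with quadratic exponent centred at `A`. -/
noncomputable def alternatingSum (q : ℂ) (N : ℕ) (A : ℤ) : ℂ :=
  ∑ p ∈ antidiagonal N, qInv q p.1 * qInv q p.2 * ((-1) ^ p.1 * q ^ triangle (A - p.1))

/-- Write 1 - q^(i+j) = (1 - q^i) + q^i (1 - q^j). The first piece shifts i and flips the sign. In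
the second, q^i merges with the quadratic exponent, leaving q^A. -/
theorem alternatingSum_succ {q : ℂ} (hq : ‖q‖ < 1) (N A : ℕ) :
    (1 - q ^ (N + 1)) * alternatingSum q (N + 1) ((A : ℤ) + 1)
      = (q ^ A - 1) * alternatingSum q N A := by
  have h1 : ∑ p ∈ antidiagonal (N + 1), (1 - q ^ p.1) * (qInv q p.1 * qInv q p.2 *
      ((-1) ^ p.1 * q ^ triangle ((A : ℤ) + 1 - p.1))) = -alternatingSum q N A := by
    rw [Nat.sum_antidiagonal_succ, alternatingSum, ← sum_neg_distrib]
    simp only [pow_zero, sub_self, zero_mul, zero_add]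
    refine sum_congr rfl fun p _ => ?_
    rw [← qInv_succ hq p.1, show (A : ℤ) + 1 - (p.1 + 1 : ℕ) = A - p.1 by push_cast; ring]
    ring
  have h2 : ∑ p ∈ antidiagonal (N + 1), q ^ p.1 * (1 - q ^ p.2) * (qInv q p.1 * qInv q p.2 *
      ((-1) ^ p.1 * q ^ triangle ((A : ℤ) + 1 - p.1))) = q ^ A * alternatingSum q N A := by
    rw [Nat.sum_antidiagonal_succ', alternatingSum, mul_sum]
    simp only [pow_zero, sub_self, zero_mul, zero_add, mul_zero]
    refine sum_congr rfl fun p _ => ?_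
    have ht := triangle_add_one (A - p.1)
    have : q ^ p.1 * q ^ triangle ((A : ℤ) + 1 - p.1) = q ^ A * q ^ triangle (A - p.1) := by
      rw [← pow_add, ← pow_add, show (A : ℤ) + 1 - p.1 = A - p.1 + 1 by ring]
      congr 1
      omega
    rw [← qInv_succ hq p.2]
    linear_combination (1 - q ^ (p.2 + 1)) * qInv q p.1 * qInv q (p.2 + 1) * (-1) ^ p.1 * this
  have hr : (q ^ A - 1) * alternatingSum q N A
      = -alternatingSum q N A + q ^ A * alternatingSum q N A := by ring
  rw [hr, ← h1, ← h2, alternatingSum, mul_sum, ← sum_add_distrib]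
  refine sum_congr rfl fun p hp => ?_
  rw [← mem_antidiagonal.mp hp, pow_add]
  ring

theorem alternatingSum_eq_zero {q : ℂ} (hq : ‖q‖ < 1) (N A : ℕ) (hA : A < N) :
    alternatingSum q N ((A : ℤ) + 1) = 0 := by
  induction N generalizing A with
  | zero => omega
  | succ N ih =>
    have h := alternatingSum_succ hq N A
    refine (mul_eq_zero.mp (h.trans ?_)).resolve_left (one_sub_pow_ne_zero hq N)
    -- Descending in A ends at the factor q^0 - 1 = 0, which is reached because A < N.
    rcases A with _ | A
    · simp
    · rw [show ((A + 1 : ℕ) : ℤ) = (A : ℤ) + 1 by push_cast; rfl, ih A (by omega), mul_zero]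

/-- The moments of the theta weight: `qWeight q M` at `2 * M`, and `0` at odd integers. -/
noncomputable def thetaMoment (q : ℂ) (N : ℤ) : ℂ := if Even N then qWeight q (N / 2) else 0

theorem neg_one_pow_eq_zpow {i : ℕ} {k : ℤ} (h : Even ((i : ℤ) - k)) :
    (-1 : ℂ) ^ k = (-1) ^ i := by
  obtain ⟨c, hc⟩ := h
  rw [← zpow_natCast, show (i : ℤ) = k + (c + c) by omega, zpow_add₀ (by norm_num),
    Even.neg_one_zpow ⟨c, rfl⟩, mul_one]

/-- For even N > 0 the two halves of `qWeight` each produce a vanishing alternating sum; for odd N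
only odd moments occur. -/
theorem sum_thetaMoment {q : ℂ} (hq : ‖q‖ < 1) (N : ℕ) :
    ∑ p ∈ antidiagonal N, qInv q p.1 * qInv q p.2 * thetaMoment q (p.1 - p.2)
      = if N = 0 then 2 else 0 := by
  rcases Nat.eq_zero_or_pos N with rfl | hN
  · simp [thetaMoment, qInv_zero, qWeight, Ring.choose_zero_pos ℤ (k := 2) (by norm_num)]
    norm_num
  rw [if_neg hN.ne']
  rcases Nat.even_or_odd' N with ⟨B, rfl | rfl⟩
  · obtain ⟨A, rfl⟩ : ∃ A, B = A + 1 := ⟨B - 1, by omega⟩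
    have hz := alternatingSum_eq_zero hq (2 * (A + 1)) A (by omega)
    have key : ∑ p ∈ antidiagonal (2 * (A + 1)),
        qInv q p.1 * qInv q p.2 * thetaMoment q (p.1 - p.2)
        = (-1) ^ (A + 1) * (alternatingSum q (2 * (A + 1)) ((A : ℤ) + 1)
          + alternatingSum q (2 * (A + 1)) ((A : ℤ) + 1)) := by
      -- With M = i - (A+1) = (A+1) - j, the half with exponent `triangle M` is the alternating sum
      -- written in j.
      have hswap : alternatingSum q (2 * (A + 1)) ((A : ℤ) + 1) =
          ∑ p ∈ antidiagonal (2 * (A + 1)), qInv q p.2 * qInv q p.1 *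
            ((-1) ^ p.2 * q ^ triangle ((A : ℤ) + 1 - p.2)) :=
        (Nat.sum_antidiagonal_swap (f := fun p : ℕ × ℕ => qInv q p.1 * qInv q p.2 *
          ((-1) ^ p.1 * q ^ triangle ((A : ℤ) + 1 - p.1)))).symm
      nth_rewrite 2 [hswap]
      rw [alternatingSum, ← sum_add_distrib, mul_sum]
      refine sum_congr rfl fun p hp => ?_
      have hp' := mem_antidiagonal.mp hp
      have hd : (p.1 : ℤ) - p.2 = 2 * (p.1 - (A + 1)) := by omega
      rw [thetaMoment, if_pos (by rw [hd]; exact even_two_mul _), hd,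
        Int.mul_ediv_cancel_left _ (by norm_num), qWeight_eq,
        neg_one_pow_eq_zpow (i := (A + 1) + p.1) ⟨A + 1, by push_cast; ring⟩,
        show (p.1 : ℤ) - (A + 1) = A + 1 - p.2 by omega,
        show -((A : ℤ) + 1 - p.2) = A + 1 - p.1 by omega]
      have hs : (-1 : ℂ) ^ p.1 = (-1) ^ p.2 := by
        rw [← zpow_natCast, neg_one_pow_eq_zpow (i := p.2)]
        exact ⟨p.2 - (A + 1), by omega⟩
      rw [hs, pow_add (-1 : ℂ) (A + 1), hs]
      ring
    rw [key, hz, add_zero, mul_zero]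
  · refine sum_eq_zero fun p hp => ?_
    have hp' := mem_antidiagonal.mp hp
    rw [thetaMoment, if_neg, mul_zero]
    rintro ⟨c, hc⟩
    omega

theorem summable_norm_qWeight {q : ℂ} (hq : ‖q‖ < 1) : Summable fun M : ℤ => ‖qWeight q M‖ := by
  obtain ⟨ρ, hqρ, hρ0, hρ1⟩ : ∃ ρ : ℝ, ‖q‖ ≤ ρ ∧ 0 < ρ ∧ ρ < 1 :=
    ⟨max ‖q‖ (1 / 2), le_max_left _ _, lt_max_of_lt_right (by norm_num), max_lt hq (by norm_num)⟩
  have hle : ∀ M : ℤ, ‖q ^ triangle M‖ ≤ ρ ^ (M.natAbs - 1) := fun M => by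
    rw [norm_pow]
    calc ‖q‖ ^ triangle M ≤ ρ ^ triangle M := by gcongr
      _ ≤ _ := pow_le_pow_of_le_one hρ0.le hρ1.le (natAbs_sub_one_le_triangle M)
  have hs : Summable fun n : ℕ => ρ ^ (n - 1) :=
    (summable_nat_add_iff 1).mp (by simpa using summable_geometric_of_lt_one hρ0.le hρ1)
  have hz : Summable fun M : ℤ => ρ ^ (M.natAbs - 1) :=
    Summable.of_nat_of_neg (by simpa using hs) (by simpa using hs)
  refine Summable.of_nonneg_of_le (fun _ => norm_nonneg _) (fun M => ?_) (hz.mul_left 2)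
  rw [qWeight_eq, norm_mul, norm_zpow, norm_neg, norm_one, one_zpow, one_mul, two_mul]
  refine (norm_add_le _ _).trans (add_le_add (hle M) ?_)
  simpa using hle (-M)

end Weight

/-! ### The moment functional, orthogonality and the Askey–Wilson integral. -/

section Functional

open MeasureTheory AddCircle

/-- The mean of a continuous function on the circle. -/
noncomputable def circleMean : C(AddCircle (1 : ℝ), ℂ) →L[ℂ] ℂ :=
  LinearMap.mkContinuous
    { toFun := fun f => ∫ t, f t ∂haarAddCircle
      map_add' := fun f g => by
        have hi : ∀ f : C(AddCircle (1 : ℝ), ℂ), Integrable f haarAddCircle := fun f =>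
          f.continuous.integrable_of_hasCompactSupport (HasCompactSupport.of_compactSpace f)
        exact integral_add (hi f) (hi g)
      map_smul' := fun c f => integral_const_mul c f }
    1 (fun f => by
      have := norm_integral_le_of_norm_le_const (μ := haarAddCircle)
        (Filter.Eventually.of_forall f.norm_coe_le_norm)
      simpa using this)

theorem circleMean_apply (f : C(AddCircle (1 : ℝ), ℂ)) :
    circleMean f = ∫ t, f t ∂haarAddCircle := rfl

theorem circleMean_fourier (n : ℤ) : circleMean (fourier n) = if n = 0 then 1 else 0 := by
  rw [circleMean_apply]
  split_ifs with h
  · subst h; simp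
  · exact integral_eq_zero_of_add_right_eq_neg (μ := haarAddCircle)
      (fourier_add_half_inv_index h one_pos)

/-- The theta function whose Fourier coefficients are the weights `qWeight q M`. -/
noncomputable def thetaWeight (q : ℂ) : C(AddCircle (1 : ℝ), ℂ) :=
  ∑' M : ℤ, qWeight q M • fourier (-(2 * M))

/-- Integration against the theta weight, the Askey–Wilson weight up to a constant. -/
noncomputable def thetaFunctional (q : ℂ) : C(AddCircle (1 : ℝ), ℂ) →L[ℂ] ℂ :=
  circleMean.comp (ContinuousLinearMap.mul ℂ _ (thetaWeight q))

theorem fourier_mul_fourier (m n : ℤ) :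
    (fourier m * fourier n : C(AddCircle (1 : ℝ), ℂ)) = fourier (m + n) := by
  ext t; simp

/-- The theta series can be averaged term by term, and only 2M = N leaves a character of nonzero
mean. -/
theorem thetaFunctional_fourier {q : ℂ} (hq : ‖q‖ < 1) (N : ℤ) :
    thetaFunctional q (fourier N) = thetaMoment q N := by
  have hs : Summable fun M : ℤ => qWeight q M • (fourier (-(2 * M)) : C(AddCircle (1 : ℝ), ℂ)) := by
    refine Summable.of_norm ?_
    simpa only [norm_smul, fourier_norm, mul_one] using summable_norm_qWeight hq
  have h := ((hs.hasSum.mul_right (fourier N)).mapL circleMean)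
  have hf : (fun M : ℤ => circleMean
      (qWeight q M • (fourier (-(2 * M)) : C(AddCircle (1 : ℝ), ℂ)) * fourier N))
      = fun M : ℤ => if 2 * M = N then qWeight q M else 0 := by
    funext M
    rw [smul_mul_assoc, map_smul, fourier_mul_fourier, circleMean_fourier]
    by_cases hM : 2 * M = N
    · simp [hM]
    · rw [if_neg hM, if_neg (by omega), smul_zero]
  rw [hf] at h
  refine h.unique ?_
  rw [thetaMoment]
  split_ifs with hN
  · obtain ⟨c, rfl⟩ := hN
    rw [show (c + c) / 2 = c by omega]
    convert hasSum_ite_eq c (qWeight q c) using 2 with M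
    by_cases hM : M = c
    · simp [hM, two_mul]
    · rw [if_neg hM, if_neg (by omega)]
  · convert hasSum_zero using 2 with M
    rw [if_neg]
    rintro rfl
    exact hN (even_two_mul M)

theorem fourier_pow (m : ℤ) (n : ℕ) :
    (fourier m ^ n : C(AddCircle (1 : ℝ), ℂ)) = fourier (n * m) := by
  induction n with
  | zero => ext t; simp
  | succ n ih => rw [pow_succ, ih, fourier_mul_fourier]; congr 1; push_cast; ring

theorem fourier_one_pow_mul (i j : ℕ) :
    (fourier 1 ^ i * fourier (-1) ^ j : C(AddCircle (1 : ℝ), ℂ)) = fourier (i - j) := by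
  rw [fourier_pow, fourier_pow, fourier_mul_fourier]; congr 1; ring

theorem fourier_one_mul_fourier_neg_one :
    (fourier 1 * fourier (-1) : C(AddCircle (1 : ℝ), ℂ)) = 1 := by
  rw [fourier_mul_fourier]; ext t; simp

theorem thetaFunctional_rogersSzego {q : ℂ} (hq : ‖q‖ < 1) (N : ℕ) :
    thetaFunctional q (rogersSzego q (fourier 1) (fourier (-1)) N) = if N = 0 then 2 else 0 := by
  rw [rogersSzego, map_sum, ← sum_thetaMoment hq]
  refine sum_congr rfl fun p _ => ?_
  rw [map_smul, fourier_one_pow_mul, thetaFunctional_fourier hq, smul_eq_mul]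

/-- Orthogonality of the continuous `q`-Hermite polynomials. -/
theorem thetaFunctional_rogersSzego_mul {q : ℂ} (hq : ‖q‖ < 1) (m n : ℕ) :
    thetaFunctional q (rogersSzego q (fourier 1) (fourier (-1)) m *
      rogersSzego q (fourier 1) (fourier (-1)) n) = if m = n then 2 * qInv q n else 0 := by
  rw [rogersSzego_mul hq, map_sum]
  simp only [fourier_one_mul_fourier_neg_one, one_pow, one_mul, map_smul,
    thetaFunctional_rogersSzego hq]
  split_ifs with h
  · subst h
    -- Only the last linearization term, k = m, reaches h_0.
    rw [sum_eq_single m]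
    · simp [qInv_zero, qPoch_zero, mul_comm]
    · intro k hk hkm
      have := mem_range.mp hk
      rw [if_neg (by omega), smul_zero]
    · intro hk
      simp at hk
  · refine sum_eq_zero fun k hk => ?_
    have := mem_range.mp hk
    rw [if_neg (by omega), smul_zero]

/-- The Askey–Wilson integral as a pairing of two Mehler series. -/
theorem thetaFunctional_mehler_mul {q : ℂ} (hq : ‖q‖ < 1) {a b c d : ℂ}
    (ha : ‖a‖ < 1) (hb : ‖b‖ < 1) (hc : ‖c‖ < 1) (hd : ‖d‖ < 1) :
    thetaFunctional q
      ((∑' p : ℕ × ℕ, mehlerCoeff q a b p • rogersSzego q (fourier 1) (fourier (-1)) (p.1 + p.2)) *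
       ∑' p : ℕ × ℕ, mehlerCoeff q c d p • rogersSzego q (fourier 1) (fourier (-1)) (p.1 + p.2))
      = 2 * ∑' p : ℕ × ℕ, mehlerCoeff q a b p • rogersSzego q c d (p.1 + p.2) := by
  have hn : ∀ n : ℤ, ‖(fourier n : C(AddCircle (1 : ℝ), ℂ))‖ ≤ 1 := fun n => (fourier_norm n).le
  have hab := summable_norm_mehler hq ha hb (hn 1) (hn (-1))
  have hcd := summable_norm_mehler hq hc hd (hn 1) (hn (-1))
  have h := ((hab.mul_norm hcd).of_norm.hasSum).mapL (thetaFunctional q)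
  rw [← tsum_mul_tsum_of_summable_norm hab hcd] at h
  rw [← tsum_mul_left]
  refine ((h.prod_fiberwise fun p => ?_).tsum_eq).symm
  -- For fixed p, orthogonality keeps only r with r.1 + r.2 = p.1 + p.2; the surviving coefficients
  -- in c, d reassemble h_(p.1 + p.2)(c, d).
  have hfin : 2 * mehlerCoeff q a b p • rogersSzego q c d (p.1 + p.2)
      = ∑ r ∈ antidiagonal (p.1 + p.2), thetaFunctional q
        (mehlerCoeff q a b p • rogersSzego q (fourier 1) (fourier (-1)) (p.1 + p.2) *
         mehlerCoeff q c d r • rogersSzego q (fourier 1) (fourier (-1)) (r.1 + r.2)) := by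
    rw [rogersSzego, smul_sum, mul_sum]
    refine sum_congr rfl fun r hr => ?_
    have hr' := mem_antidiagonal.mp hr
    rw [smul_mul_smul_comm, map_smul, thetaFunctional_rogersSzego_mul hq, if_pos hr'.symm, hr',
      mehlerCoeff, mehlerCoeff, hr']
    simp only [smul_eq_mul]
    linear_combination (-2 * (qInv q p.1 * qInv q p.2 * qPoch q q (p.1 + p.2) *
      (a ^ p.1 * b ^ p.2) * (qInv q r.1 * qInv q r.2 * (c ^ r.1 * d ^ r.2)))) *
      qPoch_mul_qInv hq (p.1 + p.2)
  rw [hfin]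
  refine hasSum_sum_of_ne_finset_zero fun r hr => ?_
  rw [smul_mul_smul_comm, map_smul, thetaFunctional_rogersSzego_mul hq, if_neg, smul_zero]
  exact fun h => hr (mem_antidiagonal.mpr h.symm)

end Functional

/-! ### Evaluation of the integral and the fourfold sum. -/

/-- The eight indices of two functions `Fin 4 → ℕ`, grouped in pairs `(m j, n j)`. -/
def finFourPairsEquiv :
    (Fin 4 → ℕ) × (Fin 4 → ℕ) ≃ ((ℕ × ℕ) × (ℕ × ℕ)) × ((ℕ × ℕ) × (ℕ × ℕ)) where
  toFun p := (((p.1 0, p.2 0), (p.1 1, p.2 1)), ((p.1 2, p.2 2), (p.1 3, p.2 3)))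
  invFun t := (![t.1.1.1, t.1.2.1, t.2.1.1, t.2.2.1], ![t.1.1.2, t.1.2.2, t.2.1.2, t.2.2.2])
  left_inv p := by
    ext i <;> fin_cases i <;> rfl
  right_inv t := rfl

theorem finFourPairsEquiv_apply (p : (Fin 4 → ℕ) × (Fin 4 → ℕ)) : finFourPairsEquiv p =
    (((p.1 0, p.2 0), (p.1 1, p.2 1)), ((p.1 2, p.2 2), (p.1 3, p.2 3))) := rfl

/-- The Askey–Wilson integral, with the theta weight normalised by its Fourier coefficients. -/
theorem thetaFunctional_eulerSeries {q : ℂ} (hq : ‖q‖ < 1) {a b c d : ℂ}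
    (ha : ‖a‖ < 1) (hb : ‖b‖ < 1) (hc : ‖c‖ < 1) (hd : ‖d‖ < 1) :
    thetaFunctional q
      ((eulerSeries q (a • fourier 1) * eulerSeries q (a • fourier (-1)) *
        (eulerSeries q (b • fourier 1) * eulerSeries q (b • fourier (-1)))) *
       (eulerSeries q (c • fourier 1) * eulerSeries q (c • fourier (-1)) *
        (eulerSeries q (d • fourier 1) * eulerSeries q (d • fourier (-1)))))
      = 2 * qPochInf (a * b * c * d) q /
        (qPochInf (a * b) q * qPochInf (a * c) q * qPochInf (a * d) q *
          qPochInf (b * c) q * qPochInf (b * d) q * qPochInf (c * d) q) := by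
  have hlt : ∀ {u v : ℂ}, ‖u‖ < 1 → ‖v‖ < 1 → ‖u * v‖ < 1 := fun hu hv => by
    rw [norm_mul]; exact mul_lt_one_of_nonneg_of_lt_one_left (norm_nonneg _) hu hv.le
  have hn : ∀ n : ℤ, ‖(fourier n : C(AddCircle (1 : ℝ), ℂ))‖ ≤ 1 := fun n => (fourier_norm n).le
  have hxy : (fourier 1 * fourier (-1) : C(AddCircle (1 : ℝ), ℂ)) = algebraMap ℂ _ 1 := by
    rw [fourier_one_mul_fourier_neg_one, map_one]
  -- The scalar q-Mehler formula, with x = c, y = d, t = cd, evaluates the collapsed series.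
  have hC := eulerSeries_smul_tsum_mehler hq ha hb hc.le hd.le (hlt hc hd).le
    (show c * d = algebraMap ℂ ℂ (c * d) from rfl)
  rw [← eulerSeries_smul_tsum_mehler hq ha hb (hn 1) (hn (-1)) norm_one.le hxy,
    ← eulerSeries_smul_tsum_mehler hq hc hd (hn 1) (hn (-1)) norm_one.le hxy,
    smul_mul_smul_comm, map_smul, thetaFunctional_mehler_mul hq ha hb hc hd, smul_eq_mul]
  simp only [smul_eq_mul, mul_one] at hC ⊢
  generalize ∑' p : ℕ × ℕ, mehlerCoeff q a b p * rogersSzego q c d (p.1 + p.2) = G at hC ⊢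
  have habcd := hlt (hlt ha hb) (hlt hc hd)
  rw [eulerSeries_eq_inv hq habcd, eulerSeries_eq_inv hq (hlt ha hc),
    eulerSeries_eq_inv hq (hlt ha hd), eulerSeries_eq_inv hq (hlt hb hc),
    eulerSeries_eq_inv hq (hlt hb hd), inv_mul_eq_iff_eq_mul₀ (qPochInf_ne_zero habcd hq)] at hC
  rw [hC, eulerSeries_eq_inv hq (hlt ha hb), eulerSeries_eq_inv hq (hlt hc hd),
    mul_assoc (a * b) c d]
  simp only [div_eq_mul_inv, mul_inv]
  ring

theorem qHermiteTerm_eq (q z₁ z₂ r s : ℂ) (m n : ℕ) :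
    qHermiteTerm q z₁ z₂ r s (m, n)
      = qHermite2D m n z₁ z₂ q / (qPoch q q m * qPoch q q n) * (r ^ m * s ^ n) := by
  rw [qHermiteTerm, qInv, qInv, div_eq_mul_inv, mul_inv, mul_assoc (qHermite2D _ _ _ _ _)]

theorem hasSum_qHermiteTerm {q : ℂ} (hq : ‖q‖ < 1) {r₁ r₂ s₁ s₂ z₁ z₂ z₃ z₄ : ℂ}
    (h₁ : ‖r₁ * z₁‖ < 1) (h₂ : ‖s₁ * z₂‖ < 1) (h₃ : ‖r₂ * z₃‖ < 1) (h₄ : ‖s₂ * z₄‖ < 1) :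
    HasSum (fun p : (Fin 4 → ℕ) × (Fin 4 → ℕ) =>
      qHermiteTerm q z₁ z₂ r₁ s₁ (p.1 0, p.2 0) * qHermiteTerm q z₁ z₂ r₁ s₁ (p.1 1, p.2 1) *
        (qHermiteTerm q z₃ z₄ r₂ s₂ (p.1 2, p.2 2) * qHermiteTerm q z₃ z₄ r₂ s₂ (p.1 3, p.2 3)) *
        thetaMoment q (indexDiff p.1 p.2))
      (2 * (qPochInf (r₁ * s₁) q ^ 2 * qPochInf (r₂ * s₂) q ^ 2 *
          qPochInf (r₁ * s₁ * r₂ * s₂ * z₁ * z₂ * z₃ * z₄) q) /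
        (qPochInf (r₁ * s₁ * z₁ * z₂) q * qPochInf (r₁ * r₂ * z₁ * z₃) q *
          qPochInf (r₁ * s₂ * z₁ * z₄) q * qPochInf (r₂ * s₁ * z₂ * z₃) q *
          qPochInf (s₁ * s₂ * z₂ * z₄) q * qPochInf (r₂ * s₂ * z₃ * z₄) q)) := by
  have hn : ∀ n : ℤ, ‖(fourier n : C(AddCircle (1 : ℝ), ℂ))‖ ≤ 1 := fun n => (fourier_norm n).le
  have hxy := fourier_one_mul_fourier_neg_one
  have hyx := hxy
  rw [mul_comm] at hyx
  obtain ⟨n0, g0⟩ := qHermite_generating hq h₁ h₂ (hn 1) (hn (-1)) hxy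
  -- Exchanging x and y here makes each parameter occur with both characters, and gives `indexDiff`
  -- its signs.
  obtain ⟨n1, g1⟩ := qHermite_generating hq h₁ h₂ (hn (-1)) (hn 1) hyx
  obtain ⟨n2, g2⟩ := qHermite_generating hq h₃ h₄ (hn 1) (hn (-1)) hxy
  obtain ⟨n3, g3⟩ := qHermite_generating hq h₃ h₄ (hn (-1)) (hn 1) hyx
  have h := ((((n0.mul_norm n1).mul_norm (n2.mul_norm n3)).of_norm.hasSum).mapL
    (thetaFunctional q))
  rw [← tsum_mul_tsum_of_summable_norm (n0.mul_norm n1) (n2.mul_norm n3),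
    ← tsum_mul_tsum_of_summable_norm n0 n1, ← tsum_mul_tsum_of_summable_norm n2 n3,
    g0.tsum_eq, g1.tsum_eq, g2.tsum_eq, g3.tsum_eq, smul_mul_smul_comm, smul_mul_smul_comm,
    smul_mul_smul_comm, map_smul] at h
  convert finFourPairsEquiv.hasSum_iff.mpr h using 1
  · funext p
    simp only [Function.comp_apply, finFourPairsEquiv_apply]
    rw [smul_mul_smul_comm, smul_mul_smul_comm, smul_mul_smul_comm, map_smul,
      mul_comm (fourier (-1) ^ p.1 1), mul_comm (fourier (-1) ^ p.1 3), fourier_one_pow_mul,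
      fourier_one_pow_mul, fourier_one_pow_mul, fourier_one_pow_mul, fourier_mul_fourier,
      fourier_mul_fourier, fourier_mul_fourier, thetaFunctional_fourier hq, smul_eq_mul, indexDiff]
    congr 2
    ring
  · have hAW := thetaFunctional_eulerSeries hq h₁ h₂ h₃ h₄
    rw [show ∀ A B C D A' B' C' D' : C(AddCircle (1 : ℝ), ℂ),
      (A * B * (A' * B')) * (C * D * (C' * D')) = (A * A' * (B' * B)) * (C * C' * (D' * D)) by
      intros; ring, hAW, smul_eq_mul,
      show r₁ * z₁ * (s₁ * z₂) * (r₂ * z₃) * (s₂ * z₄)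
        = r₁ * s₁ * r₂ * s₂ * z₁ * z₂ * z₃ * z₄ by ring,
      show r₁ * z₁ * (s₁ * z₂) = r₁ * s₁ * z₁ * z₂ by ring,
      show r₁ * z₁ * (r₂ * z₃) = r₁ * r₂ * z₁ * z₃ by ring,
      show r₁ * z₁ * (s₂ * z₄) = r₁ * s₂ * z₁ * z₄ by ring,
      show s₁ * z₂ * (r₂ * z₃) = r₂ * s₁ * z₂ * z₃ by ring,
      show s₁ * z₂ * (s₂ * z₄) = s₁ * s₂ * z₂ * z₄ by ring,
      show r₂ * z₃ * (s₂ * z₄) = r₂ * s₂ * z₃ * z₄ by ring]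
    ring

theorem theorem4p2 (q : ℂ) (hq : ‖q‖ < 1) (r₁ r₂ s₁ s₂ z₁ z₂ z₃ z₄ : ℂ)
    (h₁ : ‖r₁ * z₁‖ < 1) (h₂ : ‖s₁ * z₂‖ < 1)
    (h₃ : ‖r₂ * z₃‖ < 1) (h₄ : ‖s₂ * z₄‖ < 1) :
    HasSum
      (fun p : {p : (Fin 4 → ℕ) × (Fin 4 → ℕ) // Even (indexDiff p.1 p.2)} =>
        let m := p.1.1
        let n := p.1.2
        qHermite2D (m 0) (n 0) z₁ z₂ q * qHermite2D (m 1) (n 1) z₁ z₂ q /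
            (qPoch q q (m 0) * qPoch q q (n 0) * qPoch q q (m 1) * qPoch q q (n 1)) *
          (r₁ ^ (m 0 + m 1) * r₂ ^ (m 2 + m 3) * s₁ ^ (n 0 + n 1) * s₂ ^ (n 2 + n 3)) *
          (qHermite2D (m 2) (n 2) z₃ z₄ q * qHermite2D (m 3) (n 3) z₃ z₄ q /
            (qPoch q q (m 2) * qPoch q q (n 2) * qPoch q q (m 3) * qPoch q q (n 3))) *
          qWeight q (indexDiff m n / 2))
      (2 * (qPochInf (r₁ * s₁) q ^ 2 * qPochInf (r₂ * s₂) q ^ 2 *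
          qPochInf (r₁ * s₁ * r₂ * s₂ * z₁ * z₂ * z₃ * z₄) q) /
        (qPochInf (r₁ * s₁ * z₁ * z₂) q * qPochInf (r₁ * r₂ * z₁ * z₃) q *
          qPochInf (r₁ * s₂ * z₁ * z₄) q * qPochInf (r₂ * s₁ * z₂ * z₃) q *
          qPochInf (s₁ * s₂ * z₂ * z₄) q * qPochInf (r₂ * s₂ * z₃ * z₄) q)) := by
  have h := hasSum_qHermiteTerm hq h₁ h₂ h₃ h₄
  -- Odd moments vanish, so the sum over all indices is supported on even `indexDiff`.
  rw [← hasSum_subtype_iff_of_support_subset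
    (s := {p : (Fin 4 → ℕ) × (Fin 4 → ℕ) | Even (indexDiff p.1 p.2)})] at h
  · refine h.congr_fun ?_
    rintro ⟨⟨m, n⟩, hp⟩
    simp only [Function.comp_apply, qHermiteTerm_eq, thetaMoment]
    rw [if_pos (show Even (indexDiff m n) from hp)]
    simp only [div_eq_mul_inv, mul_inv, pow_add]
    ring
  · intro p hp
    by_contra hodd
    exact hp (by simp only [thetaMoment]; rw [if_neg (show ¬Even (indexDiff p.1 p.2) from hodd), mul_zero])
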